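/- Let $m,n\ge 1$ and $N\ge 2$ be integers, let $\Omega\subset\mathbb R^n$ be a bounded domain (a nonempty, bounded, connected open set), and let $\mathbb R^{m\times n}$ carry the inner product $\langle A,B\rangle=\operatorname{tr}(A^TB)$ and the norm $|A|=\langle A,A\rangle^{1/2}$. Let $$\Gamma=\{(p\otimes a,B): p\in\mathbb R^m,\ a\in\mathbb R^n\setminus\{0\},\ B\in\mathbb R^{m\times n},\ Ba=0\}\subset\mathbb R^{m\times n}\times\mathbb R^{m\times n},\qquad (p\otimes a)_{ij}=p_ia_j .$$ An $N$-tuple $(\xi_1,\dots,\xi_N)$ of points of $\mathbb R^{m\times n}\times\mathbb R^{m\times n}$ is a $\mathcal T_N$-configuration determined by $\rho\in\mathbb R^{m\times n}\times\mathbb R^{m\times n}$, $\gamma_1,\dots,\gamma_N\in\Gamma$ and $\kappa_1,\dots,\kappa_N>1$ if $$\gamma_1+\dots+\gamma_N=0\quad\text{and}\quad \xi_i=\pi_i+\kappa_i\gamma_i,\quad \pi_i=\rho+\sum_{j<i}\gamma_j\qquad(1\le i\le N);$$ in this case set $\mathcal T(\xi_1,\dots,\xi_N)=\bigcup_{j=1}^N[\xi_j,\pi_j]$,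 where $[\xi_j,\pi_j]$ is the closed line segment joining $\xi_j$ and $\pi_j$. **Proposition.** Let $\sigma\colon\mathbb R^{m\times n}\to\mathbb R^{m\times n}$ be continuous, with graph $\mathcal K=\{(A,\sigma(A)):A\in\mathbb R^{m\times n}\}$. Suppose that there is a $\mathcal T_N$-configuration $(\xi_1,\dots,\xi_N)$, determined by some $\rho,\gamma_1,\dots,\gamma_N,\kappa_1,\dots,\kappa_N$, such that $\xi_i\in\mathcal K$ for all $1\le i\le N$ and $\mathcal T(\xi_1,\dots,\xi_N)\setminus\mathcal K\neq\emptyset$. Then there is no $\nu>0$ for which $\sigma$ satisfies the strong quasimonotonicity condition $$\int_\Omega\langle\sigma(A+D\phi),D\phi\rangle\,dx\ \ge\ \nu\int_\Omega|D\phi|^2\,dx\qquad\text{for all }A\in\mathbb R^{m\times n}\text{ and }\phi\in C_0^\infty(\Omega;\mathbb R^m).$$ -/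

import Mathlib

open MeasureTheory
open scoped ContDiff

/-- The wave cone of the relation `u = div v`, `(Du, ∂ₜ v) ∈ K`: all pairs `(p ⊗ a, B)` of
real `m × n` matrices with `p ∈ ℝᵐ`, `a ∈ ℝⁿ \ {0}` and `B a = 0`. -/
def waveCone (m n : ℕ) : Set (Matrix (Fin m) (Fin n) ℝ × Matrix (Fin m) (Fin n) ℝ) :=
  {γ | ∃ (p : Fin m → ℝ) (a : Fin n → ℝ) (B : Matrix (Fin m) (Fin n) ℝ),
    a ≠ 0 ∧ B.mulVec a = 0 ∧ γ = (Matrix.vecMulVec p a, B)}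

/-- The point `π_i = ρ + γ_1 + ⋯ + γ_{i-1}` (indices `1, …, N` are modelled by `Fin N`). -/
def basePoint {m n N : ℕ} (ρ : Matrix (Fin m) (Fin n) ℝ × Matrix (Fin m) (Fin n) ℝ)
    (γ : Fin N → Matrix (Fin m) (Fin n) ℝ × Matrix (Fin m) (Fin n) ℝ) (i : Fin N) :
    Matrix (Fin m) (Fin n) ℝ × Matrix (Fin m) (Fin n) ℝ :=
  ρ + ∑ j ∈ Finset.Iio i, γ j

/-- `(ξ_1, …, ξ_N)` is a `T_N`-configuration determined by the data
`(ρ, γ_1, …, γ_N, κ_1, …, κ_N)`. -/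
structure IsTNConfigurationWith {m n N : ℕ}
    (ξ : Fin N → Matrix (Fin m) (Fin n) ℝ × Matrix (Fin m) (Fin n) ℝ)
    (ρ : Matrix (Fin m) (Fin n) ℝ × Matrix (Fin m) (Fin n) ℝ)
    (γ : Fin N → Matrix (Fin m) (Fin n) ℝ × Matrix (Fin m) (Fin n) ℝ)
    (κ : Fin N → ℝ) : Prop where
  mem_cone : ∀ i, γ i ∈ waveCone m n
  one_lt : ∀ i, 1 < κ i
  sum_eq_zero : ∑ i, γ i = 0
  eq_add : ∀ i, ξ i = basePoint ρ γ i + κ i • γ i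

/-- The set `T(ξ_1, …, ξ_N) = ⋃_j [ξ_j, π_j]`, formed with the points `π_j` given by the data
`ρ, γ` that determine the configuration. -/
def configurationSet {m n N : ℕ}
    (ξ : Fin N → Matrix (Fin m) (Fin n) ℝ × Matrix (Fin m) (Fin n) ℝ)
    (ρ : Matrix (Fin m) (Fin n) ℝ × Matrix (Fin m) (Fin n) ℝ)
    (γ : Fin N → Matrix (Fin m) (Fin n) ℝ × Matrix (Fin m) (Fin n) ℝ) :
    Set (Matrix (Fin m) (Fin n) ℝ × Matrix (Fin m) (Fin n) ℝ) :=
  ⋃ j : Fin N, segment ℝ (ξ j) (basePoint ρ γ j)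

/-- The graph `K = {(A, σ(A))}` of `σ`. -/
def fluxGraph {m n : ℕ} (σ : Matrix (Fin m) (Fin n) ℝ → Matrix (Fin m) (Fin n) ℝ) :
    Set (Matrix (Fin m) (Fin n) ℝ × Matrix (Fin m) (Fin n) ℝ) :=
  Set.range fun A => (A, σ A)

/-- The inner product `⟨A, B⟩ = tr(Aᵀ B)` of real matrices, so that `|A|² = ⟨A, A⟩`. -/
def frobeniusInner {m n : ℕ} (A B : Matrix (Fin m) (Fin n) ℝ) : ℝ :=
  (A.transpose * B).trace

/-- The gradient matrix `Dφ(x) = (∂φ^i / ∂x_j)`. -/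
noncomputable def gradMatrix {m n : ℕ}
    (φ : EuclideanSpace ℝ (Fin n) → EuclideanSpace ℝ (Fin m))
    (x : EuclideanSpace ℝ (Fin n)) : Matrix (Fin m) (Fin n) ℝ :=
  Matrix.of fun i j => fderiv ℝ φ x (EuclideanSpace.single j 1) i

/-- Strong quasimonotonicity of `σ` on `Ω` with constant `ν`: the inequality
`∫_Ω ⟨σ(A + Dφ), Dφ⟩ dx ≥ ν ∫_Ω |Dφ|² dx` for all matrices `A` and all
`φ ∈ C₀^∞(Ω; ℝᵐ)` (extended by zero to `ℝⁿ`). -/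
def IsStronglyQuasimonotone {m n : ℕ} (Ω : Set (EuclideanSpace ℝ (Fin n)))
    (σ : Matrix (Fin m) (Fin n) ℝ → Matrix (Fin m) (Fin n) ℝ) (ν : ℝ) : Prop :=
  ∀ (A : Matrix (Fin m) (Fin n) ℝ)
    (φ : EuclideanSpace ℝ (Fin n) → EuclideanSpace ℝ (Fin m)),
    ContDiff ℝ ∞ φ → HasCompactSupport φ → tsupport φ ⊆ Ω →
    ν * ∫ x in Ω, frobeniusInner (gradMatrix φ x) (gradMatrix φ x) ≤
      ∫ x in Ω, frobeniusInner (σ (A + gradMatrix φ x)) (gradMatrix φ x)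

/-!
Write `ξ i = (A i, B i)` and `ρ = (A, B)`. In a `T_N`-configuration `π_{i+1}` is the convex
combination `(1 - 1/κ_i) π_i + (1/κ_i) ξ_i` along a direction of the wave cone, and
`π_{N+1} = π_1 = ρ`. Going round the loop once exhibits `ρ` as the barycentre of a finite laminate
that charges `ρ` itself and, with positive weights, every `ξ i`. Two computations of the average of
`⟨A i - A, B i⟩` over this laminate are compared.

* The pairing `(X, Y) ↦ ⟨X - A, Y⟩` is affine along the wave cone, because
  `⟨p ⊗ a, B⟩ = p · B a = 0`. Hence its average is its value at `ρ`, which is `0`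
  (`frobeniusInner_affine_of_mem_waveCone`).
* Since `B i = σ (A i)`, the difference `⟨A i - A, B i⟩ - ν |A i - A|²` is the integrand
  `g(L) = ⟨σ(A + L), L⟩ - ν |L|²` at `L = A i - A`. Strong quasimonotonicity says that `g` is
  quasiconvex at `0`, and `g 0 = 0`, so Jensen's inequality for the rank-one laminate of the
  matrices `A i` makes the average of `g` nonnegative (`QuasiconvexAtZero.nonneg_of_loop`).

Therefore every `A i` equals `A`, all `ξ i` equal `(A, σ A)`, the loop collapses to this point
(`IsTNConfigurationWith.basePoint_eq_of_const`), and the configuration set lies in the graph.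

Jensen's inequality for the laminate is obtained without constructing nested oscillating test
functions. Quasiconvexity at the origin is first transferred from `Ω` to the whole space by scaling.
Then a single rapid oscillation `χ(x) h(k a·x) p / k`, added to a test function `φ`, is averaged in
the fast variable (`QuasiconvexAtZero.integral_oscillation_nonneg`). With `χ = θ(Dφ)`, where the
bump `θ` is concentrated near one matrix `X` and vanishes at `0`, this says that `g` may be replaced
by the integrand `Y ↦ ∫₀¹ g(Y + θ(Y) h'(s) p ⊗ a) ds`, which is quasiconvex at the origin again, and
whose value at `X` is close to the average of `g` over a rank-one splitting of `X`. Repeating the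
replacement follows the chain `π_1, π_2, …, π_{N+1}`.
-/

open Filter Topology Set Function

/-! ### Periodic profiles imitating a step function -/

theorem integral_ite_cos_lt_cos {lam : ℝ} (h0 : 0 < lam) (h1 : lam < 1) (α β : ℝ) :
    ∫ s in (0 : ℝ)..1, (if Real.cos (Real.pi * lam) < Real.cos (2 * Real.pi * s) then α else β) =
      lam * α + (1 - lam) * β := by
  have hper : Periodic (fun s : ℝ =>
      if Real.cos (Real.pi * lam) < Real.cos (2 * Real.pi * s) then α else β) 1 := by
    intro s
    have : Real.cos (2 * Real.pi * (s + 1)) = Real.cos (2 * Real.pi * s) := by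
      rw [mul_add, mul_one, Real.cos_add_two_pi]
    simp only [this]
  have hshift := hper.intervalIntegral_add_eq 0 (-(1 / 2))
  rw [zero_add] at hshift
  rw [hshift, intervalIntegral.integral_of_le (by norm_num)]
  have hpi := Real.pi_pos
  have hiff : ∀ s ∈ Ioc (-(1 / 2) : ℝ) (-(1 / 2) + 1),
      (Real.cos (Real.pi * lam) < Real.cos (2 * Real.pi * s) ↔ s ∈ Ioo (-(lam / 2)) (lam / 2)) := by
    intro s hs
    have hs' : |s| ≤ 1 / 2 := abs_le.2 ⟨hs.1.le, by linarith [hs.2]⟩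
    have habs : Real.cos (2 * Real.pi * s) = Real.cos (2 * Real.pi * |s|) := by
      rw [← Real.cos_abs, abs_mul, abs_of_pos (by positivity : 0 < 2 * Real.pi)]
    rw [habs, Real.strictAntiOn_cos.lt_iff_gt (by constructor <;> nlinarith)
      (by constructor <;> nlinarith [abs_nonneg s]), mem_Ioo, ← abs_lt]
    constructor
    · intro h
      have : 2 * |s| < lam := by
        by_contra! hc
        nlinarith
      linarith
    · intro h
      nlinarith
  have hcongr : ∫ s in Ioc (-(1 / 2) : ℝ) (-(1 / 2) + 1),
      (if Real.cos (Real.pi * lam) < Real.cos (2 * Real.pi * s) then α else β) =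
      ∫ s in Ioc (-(1 / 2) : ℝ) (-(1 / 2) + 1),
        ((Ioo (-(lam / 2)) (lam / 2)).indicator (fun _ => α - β) s + β) := by
    refine setIntegral_congr_fun measurableSet_Ioc fun s hs => ?_
    by_cases h : s ∈ Ioo (-(lam / 2)) (lam / 2)
    · simp [(hiff s hs).2 h, h]
    · simp [mt (hiff s hs).1 h, h]
  have hsub : Ioo (-(lam / 2)) (lam / 2) ⊆ Ioc (-(1 / 2) : ℝ) (-(1 / 2) + 1) :=
    fun s hs => ⟨by linarith [hs.1], by linarith [hs.2]⟩
  rw [hcongr, integral_add, setIntegral_indicator measurableSet_Ioo, inter_eq_right.2 hsub]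
  · simp only [integral_const, smul_eq_mul, measureReal_restrict_apply_univ, Real.volume_real_Ioc,
      Real.volume_real_Ioo]
    rw [max_eq_left (by linarith), max_eq_left (by linarith)]
    ring
  · exact (integrable_const _).indicator measurableSet_Ioo
  · exact integrable_const _

/-- Smooth profiles imitating the two-valued step function that equals `1 - lam` on a proportion
`lam` of each period and `-lam` on the rest. -/
theorem exists_smooth_periodic_profile {lam : ℝ} (h0 : 0 < lam) (h1 : lam < 1) :
    ∃ v : ℕ → ℝ → ℝ, (∀ k, ContDiff ℝ ∞ (v k)) ∧ (∀ k, Periodic (v k) 1) ∧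
      (∀ k, ∫ s in (0 : ℝ)..1, v k s = 0) ∧
      ∀ G : ℝ → ℝ, Continuous G →
        Tendsto (fun k => ∫ s in (0 : ℝ)..1, G (v k s)) atTop
          (𝓝 (lam * G (1 - lam) + (1 - lam) * G (-lam))) := by
  -- The set where `d` is positive occupies a proportion `lam` of each period; the steepened smooth
  -- cutoffs `w k` of `d` converge pointwise to its indicator `l`.
  set d : ℝ → ℝ := fun s => Real.cos (2 * Real.pi * s) - Real.cos (Real.pi * lam) with hd
  set w : ℕ → ℝ → ℝ := fun k s => Real.smoothTransition (k * d s) with hw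
  have hdc : ContDiff ℝ ∞ d := by
    have : ContDiff ℝ ∞ fun s : ℝ => 2 * Real.pi * s := contDiff_const.mul contDiff_id
    exact (Real.contDiff_cos.comp this).sub contDiff_const
  have hwc : ∀ k, ContDiff ℝ ∞ (w k) := fun k =>
    Real.smoothTransition.contDiff.comp (contDiff_const.mul hdc)
  have hwper : ∀ k, Periodic (w k) 1 := by
    intro k s
    have : d (s + 1) = d s := by
      simp only [hd]
      rw [mul_add, mul_one, Real.cos_add_two_pi]
    simp only [hw, this]
  set l : ℝ → ℝ := fun s =>
    if Real.cos (Real.pi * lam) < Real.cos (2 * Real.pi * s) then 1 else 0 with hl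
  have hlim : ∀ s, Tendsto (fun k => w k s) atTop (𝓝 (l s)) := by
    intro s
    by_cases h : Real.cos (Real.pi * lam) < Real.cos (2 * Real.pi * s)
    · have hpos : 0 < d s := by simp only [hd]; linarith
      have hev : ∀ᶠ k : ℕ in atTop, w k s = l s := by
        have := (tendsto_natCast_atTop_atTop (R := ℝ)).atTop_mul_const hpos
        filter_upwards [this.eventually_ge_atTop 1] with k hk
        simp only [hw, hl, if_pos h]
        exact Real.smoothTransition.one_of_one_le hk
      exact tendsto_const_nhds.congr' (hev.mono fun k hk => hk.symm)
    · have hev : ∀ k : ℕ, l s = w k s := by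
        intro k
        simp only [hw, hl, if_neg h]
        refine (Real.smoothTransition.zero_of_nonpos ?_).symm
        have : d s ≤ 0 := by simp only [hd]; linarith
        exact mul_nonpos_of_nonneg_of_nonpos (Nat.cast_nonneg k) this
      exact tendsto_const_nhds.congr hev
  set mean : ℕ → ℝ := fun k => ∫ s in (0 : ℝ)..1, w k s with hmean
  have hw01 : ∀ k s, w k s ∈ Icc (0 : ℝ) 1 := fun k s =>
    ⟨Real.smoothTransition.nonneg _, Real.smoothTransition.le_one _⟩
  have hmeanlim : Tendsto mean atTop (𝓝 lam) := by
    have hval : ∫ s in (0 : ℝ)..1, l s = lam := by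
      simp only [hl]
      rw [integral_ite_cos_lt_cos h0 h1]
      ring
    rw [← hval]
    refine intervalIntegral.tendsto_integral_filter_of_dominated_convergence (fun _ => (1 : ℝ))
      (.of_forall fun k => (hwc k).continuous.aestronglyMeasurable)
      (.of_forall fun k => .of_forall fun s _ => ?_) (by simp) (.of_forall fun s _ => hlim s)
    rw [Real.norm_of_nonneg (hw01 k s).1]
    exact (hw01 k s).2
  have hmean01 : ∀ k, mean k ∈ Icc (0 : ℝ) 1 := by
    intro k
    refine ⟨intervalIntegral.integral_nonneg zero_le_one fun s _ => (hw01 k s).1, ?_⟩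
    have := intervalIntegral.integral_mono_on (μ := volume) zero_le_one
      ((hwc k).continuous.intervalIntegrable 0 1)
      (intervalIntegrable_const (c := (1 : ℝ))) fun s _ => (hw01 k s).2
    simpa using this
  refine ⟨fun k s => w k s - mean k, fun k => (hwc k).sub contDiff_const,
    fun k s => by simp only [hwper k s], fun k => ?_, fun G hG => ?_⟩
  · rw [intervalIntegral.integral_sub ((hwc k).continuous.intervalIntegrable 0 1)
      intervalIntegrable_const]
    simp [hmean]
  · have hval : ∫ s in (0 : ℝ)..1, G (l s - lam) = lam * G (1 - lam) + (1 - lam) * G (-lam) := by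
      rw [← integral_ite_cos_lt_cos h0 h1]
      congr 1
      funext s
      simp only [hl]
      split_ifs <;> simp
    obtain ⟨C, hC⟩ := (isCompact_Icc (a := (-1 : ℝ)) (b := 1)).exists_bound_of_continuousOn
      hG.continuousOn
    rw [← hval]
    refine intervalIntegral.tendsto_integral_filter_of_dominated_convergence (fun _ => C)
      (.of_forall fun k =>
        (hG.comp ((hwc k).continuous.sub continuous_const)).aestronglyMeasurable)
      (.of_forall fun k => .of_forall fun s _ => hC _ ?_) (by simp)
      (.of_forall fun s _ => (hG.tendsto _).comp ((hlim s).sub hmeanlim))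
    have h1 := hw01 k s
    have h2 := hmean01 k
    exact ⟨by linarith [h1.1, h2.2], by linarith [h1.2, h2.1]⟩

/-! ### Quasiconvexity at the origin and rapid oscillations -/

section Relaxation

variable {E F : Type*} [NormedAddCommGroup E] [NormedSpace ℝ E] [FiniteDimensional ℝ E]
  [MeasurableSpace E] [BorelSpace E] [NormedAddCommGroup F] [NormedSpace ℝ F]
  {μ : Measure E} [μ.IsAddHaarMeasure]

/-- A continuous integrand `g` with `g 0 = 0` that is quasiconvex at the origin: its integral over
the gradient of any test function on the whole space is nonnegative. The normalisation `g 0 = 0`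
makes these integrals converge. -/
structure QuasiconvexAtZero (μ : Measure E) (g : (E →L[ℝ] F) → ℝ) : Prop where
  continuous : Continuous g
  map_zero : g 0 = 0
  integral_nonneg : ∀ φ : E → F, ContDiff ℝ ∞ φ → HasCompactSupport φ →
    0 ≤ ∫ x, g (fderiv ℝ φ x) ∂μ

/-- A primitive of a smooth periodic function of mean zero is smooth and bounded. -/
theorem exists_bounded_primitive {v : ℝ → ℝ} (hv : ContDiff ℝ ∞ v) (hper : Periodic v 1)
    (hmean : ∫ s in (0 : ℝ)..1, v s = 0) :
    ∃ h : ℝ → ℝ, ContDiff ℝ ∞ h ∧ (∀ s, HasDerivAt h (v s) s) ∧ ∃ C, ∀ s, |h s| ≤ C := by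
  have hd : ∀ s, HasDerivAt (fun t => ∫ r in (0 : ℝ)..t, v r) (v s) s := fun s =>
    (hv.continuous.integral_hasStrictDerivAt 0 s).hasDerivAt
  have hsmooth : ContDiff ℝ ∞ (fun t => ∫ r in (0 : ℝ)..t, v r) := by
    rw [contDiff_infty_iff_deriv]
    refine ⟨fun s => (hd s).differentiableAt, ?_⟩
    rwa [funext fun s => (hd s).deriv]
  have hhper : Periodic (fun t => ∫ r in (0 : ℝ)..t, v r) 1 := by
    intro s
    have h1 := hper.intervalIntegral_add_eq s 0
    rw [zero_add, hmean] at h1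
    change ∫ r in (0 : ℝ)..(s + 1), v r = ∫ r in (0 : ℝ)..s, v r
    rw [← intervalIntegral.integral_add_adjacent_intervals
      (hv.continuous.intervalIntegrable 0 s) (hv.continuous.intervalIntegrable s (s + 1)), h1,
      add_zero]
  obtain ⟨C, hC⟩ := (hhper.isBounded_of_continuous one_ne_zero
    hsmooth.continuous).exists_norm_le
  exact ⟨_, hsmooth, hd, C, fun s => hC _ (mem_range_self s)⟩

/-- Two-scale test functions: a test function `φ` may be perturbed by rapid oscillations in the
direction `ℓ`, with amplitude `χ`, and in the limit the fast variable is averaged out. -/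
theorem QuasiconvexAtZero.integral_oscillation_nonneg {g : (E →L[ℝ] F) → ℝ}
    (hg : QuasiconvexAtZero μ g) {φ : E → F} (hφ : ContDiff ℝ ∞ φ) (hφc : HasCompactSupport φ)
    {χ : E → ℝ} (hχ : ContDiff ℝ ∞ χ) (hχc : HasCompactSupport χ)
    {ℓ : E →L[ℝ] ℝ} (hℓ : ℓ ≠ 0) (p : F)
    {v : ℝ → ℝ} (hv : ContDiff ℝ ∞ v) (hper : Periodic v 1)
    (hmean : ∫ s in (0 : ℝ)..1, v s = 0) :
    0 ≤ ∫ x, (∫ s in (0 : ℝ)..1, g (fderiv ℝ φ x + (χ x * v s) • ℓ.smulRight p)) ∂μ := by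
  obtain ⟨h, hh, hhd, H, hH⟩ := exists_bounded_primitive hv hper hmean
  obtain ⟨V, hV⟩ := (hper.isBounded_of_continuous one_ne_zero hv.continuous).exists_norm_le
  replace hV : ∀ s, |v s| ≤ V := fun s => hV _ (mem_range_self s)
  obtain ⟨b, hb⟩ : ∃ b, ℓ b = 1 := by
    obtain ⟨c, hc⟩ := DFunLike.ne_iff.1 hℓ
    exact ⟨(ℓ c)⁻¹ • c, by simpa using inv_mul_cancel₀ hc⟩
  have hφ' : Continuous (fderiv ℝ φ) := hφ.continuous_fderiv (by simp)
  have hχ' : Continuous (fderiv ℝ χ) := hχ.continuous_fderiv (by simp)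
  -- `Γ x r e` is the gradient at `x` when the profile has slope `r` and scaled height `e`.
  set Γ : E → ℝ → ℝ → (E →L[ℝ] F) := fun x r e =>
    fderiv ℝ φ x + (χ x * r) • ℓ.smulRight p + e • (fderiv ℝ χ x).smulRight p with hΓ
  have hΓc : Continuous fun q : E × ℝ × ℝ => Γ q.1 q.2.1 q.2.2 := by
    have h1 : Continuous fun q : E × ℝ × ℝ => (fderiv ℝ χ q.1).smulRight p :=
      ((ContinuousLinearMap.smulRightL ℝ E F).flip p).continuous.comp (hχ'.comp continuous_fst)
    have h2 := hχ.continuous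
    simp only [hΓ]
    fun_prop
  set K : Set E := tsupport φ ∪ tsupport χ with hK
  have hKc : IsCompact K := hφc.isCompact.union hχc.isCompact
  have hΓ0 : ∀ x ∉ K, ∀ r e, g (Γ x r e) = 0 := by
    intro x hx r e
    have h1 : x ∉ tsupport φ := fun h => hx (Or.inl h)
    have h2 : x ∉ tsupport χ := fun h => hx (Or.inr h)
    have e1 : fderiv ℝ φ x = 0 := notMem_support.1 fun h => h1 (support_fderiv_subset ℝ h)
    have e2 : fderiv ℝ χ x = 0 := notMem_support.1 fun h => h2 (support_fderiv_subset ℝ h)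
    have e3 : χ x = 0 := image_eq_zero_of_notMem_tsupport h2
    have e4 : (0 : E →L[ℝ] ℝ).smulRight p = 0 := by ext; simp
    simp [hΓ, e1, e2, e3, e4, hg.map_zero]
  -- A compact set outside which all slightly translated integrands vanish.
  set K' : Set E := (fun q : ℝ × E => q.2 - q.1 • b) '' (Icc (0 : ℝ) 1 ×ˢ K) with hK'
  have hK'c : IsCompact K' := (isCompact_Icc.prod hKc).image (by fun_prop)
  have hKK' : ∀ x ∉ K', ∀ δ ∈ Icc (0 : ℝ) 1, x + δ • b ∉ K := fun x hx δ hδ hxK =>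
    hx ⟨(δ, x + δ • b), ⟨hδ, hxK⟩, by simp⟩
  set I : ℝ := ∫ x, (∫ s in (0 : ℝ)..1, g (fderiv ℝ φ x + (χ x * v s) • ℓ.smulRight p)) ∂μ with hI
  have key : ∀ ε > 0, -(ε * μ.real K') ≤ I := by
    intro ε hε
    have huc : UniformContinuousOn
        (fun q : (ℝ × ℝ) × E × ℝ => g (Γ (q.2.1 + q.1.1 • b) q.2.2 q.1.2))
        ((Icc (0 : ℝ) 1 ×ˢ Icc (-H) H) ×ˢ K' ×ˢ Icc (-V) V) := by
      refine IsCompact.uniformContinuousOn_of_continuous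
        ((isCompact_Icc.prod isCompact_Icc).prod (hK'c.prod isCompact_Icc))
        (Continuous.continuousOn ?_)
      exact hg.continuous.comp (hΓc.comp (by fun_prop :
        Continuous fun q : (ℝ × ℝ) × E × ℝ => (q.2.1 + q.1.1 • b, q.2.2, q.1.2)))
    obtain ⟨δ, hδ, hδε⟩ := Metric.uniformContinuousOn_iff.1 huc ε hε
    have hH0 : 0 ≤ H := (abs_nonneg _).trans (hH 0)
    obtain ⟨k, hk⟩ := exists_nat_gt (max 1 ((1 + H) / δ))
    have hk1 : (1 : ℝ) < k := (le_max_left _ _).trans_lt hk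
    have hk0 : (0 : ℝ) < k := by linarith
    have hkδ : (1 + H) / k < δ := by
      have := (le_max_right _ _).trans_lt hk
      rw [div_lt_iff₀ hδ] at this
      rwa [div_lt_iff₀ hk0, mul_comm]
    have hkH : ∀ t, |h t / k| ≤ H / k := fun t => by
      rw [abs_div, abs_of_pos hk0]
      exact div_le_div_of_nonneg_right (hH t) hk0.le
    -- The test function that oscillates at frequency `k`.
    set ψ : E → F := fun x => φ x + (χ x * (h (k * ℓ x) / k)) • p with hψ
    have hψs : ContDiff ℝ ∞ ψ := by
      have h1 : ContDiff ℝ ∞ fun x => h (k * ℓ x) :=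
        hh.comp (contDiff_const.mul ℓ.contDiff)
      exact hφ.add ((hχ.mul (h1.div_const _)).smul contDiff_const)
    have hψc : HasCompactSupport ψ := by
      refine hφc.add ?_
      exact (hχc.mul_right (f' := fun x => h (k * ℓ x) / k)).smul_right
        (f' := fun _ => p)
    have hψ' : ∀ x, fderiv ℝ ψ x = Γ x (v (k * ℓ x)) (h (k * ℓ x) / k) := by
      intro x
      have h1 : HasFDerivAt (fun x => h (k * ℓ x) / k) (v (k * ℓ x) • ℓ) x := by
        have := ((hhd (k * ℓ x)).comp_hasFDerivAt x (ℓ.hasFDerivAt.const_mul (k : ℝ))).mul_const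
          ((k : ℝ)⁻¹)
        refine (this.congr_fderiv ?_)
        ext y
        simp
        field_simp
      have h2 := ((hφ.differentiable (by simp)) x).hasFDerivAt.add
        ((((hχ.differentiable (by simp)) x).hasFDerivAt.mul h1).smul_const p)
      rw [HasFDerivAt.fderiv (f := ψ) h2]
      ext y
      simp [hΓ]
      module
    have hpos := hg.integral_nonneg ψ hψs hψc
    simp only [hψ'] at hpos
    have hfrac : ∀ s ∈ Icc (0 : ℝ) 1, s / k ∈ Icc (0 : ℝ) 1 := fun s hs =>
      ⟨div_nonneg hs.1 hk0.le, (div_le_one hk0).2 (hs.2.trans hk1.le)⟩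
    -- For each phase `s`, translating by `(s / k) • b` shifts the fast variable by `s`.
    have hslice : ∀ s ∈ Icc (0 : ℝ) 1,
        -(ε * μ.real K') ≤ ∫ x, g (Γ x (v (k * ℓ x + s)) 0) ∂μ := by
      intro s hs
      have hvc := hv.continuous
      have hhc := hh.continuous
      set f₁ : E → ℝ := fun x =>
        g (Γ (x + (s / k) • b) (v (k * ℓ x + s)) (h (k * ℓ x + s) / k)) with hf₁
      set f₂ : E → ℝ := fun x => g (Γ x (v (k * ℓ x + s)) 0) with hf₂
      have hshift : ∫ x, f₁ x ∂μ = ∫ x, g (Γ x (v (k * ℓ x)) (h (k * ℓ x) / k)) ∂μ := by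
        rw [← integral_add_right_eq_self
          (fun x => g (Γ x (v (k * ℓ x)) (h (k * ℓ x) / k))) ((s / k) • b)]
        congr 1
        funext x
        have : (k : ℝ) * ℓ (x + (s / k) • b) = k * ℓ x + s := by
          simp [hb]
          field_simp
        simp only [hf₁, this]
      have hf₁0 : ∀ x ∉ K', f₁ x = 0 := fun x hx => hΓ0 _ (hKK' x hx _ (hfrac s hs)) _ _
      have hf₂0 : ∀ x ∉ K', f₂ x = 0 := fun x hx =>
        hΓ0 _ (by simpa using hKK' x hx 0 (by simp)) _ _
      have hf₁c : Continuous f₁ := hg.continuous.comp (hΓc.comp (by fun_prop :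
        Continuous fun x : E => (x + (s / k) • b, v (k * ℓ x + s), h (k * ℓ x + s) / k)))
      have hf₂c : Continuous f₂ := hg.continuous.comp (hΓc.comp (by fun_prop :
        Continuous fun x : E => (x, v (k * ℓ x + s), (0 : ℝ))))
      have hi₁ : Integrable f₁ μ :=
        hf₁c.integrable_of_hasCompactSupport (HasCompactSupport.intro hK'c hf₁0)
      have hi₂ : Integrable f₂ μ :=
        hf₂c.integrable_of_hasCompactSupport (HasCompactSupport.intro hK'c hf₂0)
      have hdiff : ‖∫ x, (f₁ x - f₂ x) ∂μ‖ ≤ ε * μ.real K' := by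
        rw [← setIntegral_eq_integral_of_forall_compl_eq_zero (s := K')
          (fun x hx => by rw [hf₁0 x hx, hf₂0 x hx, sub_zero])]
        refine norm_setIntegral_le_of_norm_le_const hK'c.measure_lt_top fun x hx => ?_
        have hvm : v (k * ℓ x + s) ∈ Icc (-V) V := abs_le.1 (hV _)
        have hhk : |h (k * ℓ x + s) / k| ≤ H := (hkH _).trans (div_le_self hH0 hk1.le)
        have := hδε ((s / k, h (k * ℓ x + s) / k), x, v (k * ℓ x + s))
          ⟨⟨hfrac s hs, abs_le.1 hhk⟩, hx, hvm⟩ ((0, 0), x, v (k * ℓ x + s))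
          ⟨⟨by simp, by simpa using hH0⟩, hx, hvm⟩ ?_
        · rw [Real.dist_eq] at this
          simpa [hf₁, hf₂] using this.le
        · have h1 : |s / k| < δ := by
            rw [abs_of_nonneg (hfrac s hs).1]
            refine lt_of_le_of_lt ?_ hkδ
            exact div_le_div_of_nonneg_right (by linarith [hs.2]) hk0.le
          have h2 : |h (k * ℓ x + s) / k| < δ := by
            refine lt_of_le_of_lt ((hkH _).trans ?_) hkδ
            exact div_le_div_of_nonneg_right (by linarith) hk0.le
          simp only [Prod.dist_eq, dist_self, Real.dist_eq, sub_zero]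
          exact max_lt (max_lt h1 h2) (by simpa using hδ)
      rw [integral_sub hi₁ hi₂, hshift] at hdiff
      have := (abs_le.1 hdiff).2
      linarith
    -- Averaging over the phase removes the fast variable.
    have hIeq : I = ∫ s in (0 : ℝ)..1, ∫ x, g (Γ x (v (k * ℓ x + s)) 0) ∂μ := by
      have hvc := hv.continuous
      rw [intervalIntegral_integral_swap]
      · rw [hI]
        congr 1
        funext x
        have hp : Periodic (fun s => g (Γ x (v s) 0)) 1 := fun s => by simp only [hper s]
        have h1 := hp.intervalIntegral_add_eq 0 (k * ℓ x)
        rw [zero_add] at h1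
        rw [intervalIntegral.integral_comp_add_left (fun s => g (Γ x (v s) 0)) (k * ℓ x), add_zero,
          ← h1]
        simp [hΓ]
      · rw [uIoc_of_le zero_le_one]
        have hc : Continuous (uncurry fun (s : ℝ) (x : E) => g (Γ x (v (k * ℓ x + s)) 0)) :=
          hg.continuous.comp (hΓc.comp (by fun_prop :
            Continuous fun q : ℝ × E => (q.2, v (k * ℓ q.2 + q.1), (0 : ℝ))))
        have h1 : IntegrableOn (uncurry fun (s : ℝ) (x : E) => g (Γ x (v (k * ℓ x + s)) 0))
            (Icc (0 : ℝ) 1 ×ˢ K) ((volume : Measure ℝ).prod μ) :=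
          hc.continuousOn.integrableOn_compact (isCompact_Icc.prod hKc)
        have h2 : IntegrableOn (uncurry fun (s : ℝ) (x : E) => g (Γ x (v (k * ℓ x + s)) 0))
            (Icc (0 : ℝ) 1 ×ˢ univ) ((volume : Measure ℝ).prod μ) := by
          refine h1.of_forall_sdiff_eq_zero (measurableSet_Icc.prod .univ) ?_
          rintro ⟨s, x⟩ ⟨⟨hs, -⟩, hx⟩
          exact hΓ0 x (fun hxK => hx ⟨hs, hxK⟩) _ _
        rw [IntegrableOn, ← Measure.prod_restrict, Measure.restrict_univ] at h2
        exact h2.mono_measure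
          (Measure.prod_mono (Measure.restrict_mono Ioc_subset_Icc_self le_rfl) le_rfl)
    rw [hIeq]
    by_cases hint : IntervalIntegrable (fun s => ∫ x, g (Γ x (v (k * ℓ x + s)) 0) ∂μ) volume 0 1
    · have := intervalIntegral.integral_mono_on zero_le_one intervalIntegrable_const hint hslice
      simpa using this
    -- The value `0` of the undefined integral satisfies the bound as well.
    · rw [intervalIntegral.integral_undef hint]
      have : 0 ≤ μ.real K' := measureReal_nonneg
      nlinarith
  have hlim : Tendsto (fun ε : ℝ => -(ε * μ.real K')) (𝓝[>] 0) (𝓝 0) := by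
    have : Continuous fun ε : ℝ => -(ε * μ.real K') := by fun_prop
    simpa using (this.tendsto 0).mono_left nhdsWithin_le_nhds
  exact le_of_tendsto hlim (eventually_mem_nhdsWithin.mono key)

end Relaxation

/-! ### Splitting a gradient along a rank-one line -/

section Relaxation

variable {E F : Type*} [NormedAddCommGroup E] [NormedSpace ℝ E] [FiniteDimensional ℝ E]
  [MeasurableSpace E] [BorelSpace E] [NormedAddCommGroup F] [NormedSpace ℝ F]
  {μ : Measure E} [μ.IsAddHaarMeasure]

/-- An integrand which is quasiconvex at the origin does not exceed, at the origin, its average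
over an oscillation between multiples of a rank-one map. -/
theorem QuasiconvexAtZero.intervalIntegral_nonneg {g : (E →L[ℝ] F) → ℝ}
    (hg : QuasiconvexAtZero μ g) {ℓ : E →L[ℝ] ℝ} (hℓ : ℓ ≠ 0) (p : F)
    {v : ℝ → ℝ} (hv : ContDiff ℝ ∞ v) (hper : Periodic v 1)
    (hmean : ∫ s in (0 : ℝ)..1, v s = 0) :
    0 ≤ ∫ s in (0 : ℝ)..1, g (v s • ℓ.smulRight p) := by
  set G : ℝ → ℝ := fun t => ∫ s in (0 : ℝ)..1, g ((t * v s) • ℓ.smulRight p) with hG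
  have hGc : Continuous G := by
    have hgc := hg.continuous
    have hvc := hv.continuous
    exact intervalIntegral.continuous_parametric_intervalIntegral_of_continuous'
      (by simp only [uncurry_def]; fun_prop) 0 1
  have hG0 : G 0 = 0 := by simp [hG, hg.map_zero]
  -- Cutoffs decreasing to the indicator of the closed unit ball.
  let f : ℕ → ContDiffBump (0 : E) := fun j =>
    ⟨1, 1 + 1 / (j + 1), one_pos, by simpa using (by positivity : (0 : ℝ) < (j : ℝ) + 1)⟩
  have hnonneg : ∀ j, 0 ≤ ∫ x, G (f j x) ∂μ := by
    intro j
    have := hg.integral_oscillation_nonneg (φ := 0) contDiff_const HasCompactSupport.zero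
      (f j).contDiff (f j).hasCompactSupport hℓ p hv hper hmean
    simpa [hG] using this
  obtain ⟨C, hC⟩ := (isCompact_Icc (a := (0 : ℝ)) (b := 1)).exists_bound_of_continuousOn
    hGc.continuousOn
  have hlim : Tendsto (fun j => ∫ x, G (f j x) ∂μ) atTop
      (𝓝 (∫ x, (Metric.closedBall (0 : E) 1).indicator (fun _ => G 1) x ∂μ)) := by
    refine tendsto_integral_of_dominated_convergence
      ((Metric.closedBall (0 : E) 2).indicator fun _ => C)
      (fun j => (hGc.comp (f j).continuous).aestronglyMeasurable)
      ((integrable_indicator_iff Metric.isClosed_closedBall.measurableSet).2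
        (integrableOn_const (measure_closedBall_lt_top.ne))) (fun j => .of_forall fun x => ?_)
      (.of_forall fun x => ?_)
    · by_cases hx : x ∈ Metric.closedBall (0 : E) 2
      · rw [indicator_of_mem hx]
        exact hC _ ⟨(f j).nonneg, (f j).le_one⟩
      · rw [indicator_of_notMem hx, (f j).zero_of_le_dist, hG0, norm_zero]
        have h1 : (1 : ℝ) / (j + 1) ≤ 1 := by
          rw [div_le_one (by positivity)]
          linarith [(Nat.cast_nonneg j : (0 : ℝ) ≤ j)]
        have h2 : 2 < dist x 0 := not_le.1 hx
        change 1 + 1 / ((j : ℝ) + 1) ≤ dist x 0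
        linarith
    · by_cases hx : x ∈ Metric.closedBall (0 : E) 1
      · rw [indicator_of_mem hx]
        refine tendsto_const_nhds.congr fun j => ?_
        rw [(f j).one_of_mem_closedBall hx]
      · rw [indicator_of_notMem hx]
        have h2 : 0 < dist x 0 - 1 := sub_pos.2 (not_le.1 hx)
        refine tendsto_const_nhds.congr' ?_
        filter_upwards [tendsto_one_div_add_atTop_nhds_zero_nat.eventually_lt_const h2] with j hj
        rw [(f j).zero_of_le_dist, hG0]
        change 1 + 1 / ((j : ℝ) + 1) ≤ dist x 0
        linarith
  have h0 := ge_of_tendsto' hlim hnonneg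
  rw [integral_indicator Metric.isClosed_closedBall.measurableSet, setIntegral_const,
    smul_eq_mul] at h0
  have hvol : 0 < μ.real (Metric.closedBall (0 : E) 1) :=
    ENNReal.toReal_pos (Metric.measure_closedBall_pos μ 0 one_pos).ne'
      measure_closedBall_lt_top.ne
  have hG1 : 0 ≤ G 1 := nonneg_of_mul_nonneg_right h0 hvol
  simpa [hG] using hG1

/-- Splitting where the gradient is near a prescribed value: taking the cutoff `θ ∘ Dφ` as
amplitude of the oscillation preserves quasiconvexity at the origin. -/
theorem QuasiconvexAtZero.average {g : (E →L[ℝ] F) → ℝ}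
    (hg : QuasiconvexAtZero μ g) {ℓ : E →L[ℝ] ℝ} (hℓ : ℓ ≠ 0) (p : F)
    {v : ℝ → ℝ} (hv : ContDiff ℝ ∞ v) (hper : Periodic v 1)
    (hmean : ∫ s in (0 : ℝ)..1, v s = 0)
    {θ : (E →L[ℝ] F) → ℝ} (hθ : ContDiff ℝ ∞ θ) (hθ0 : θ 0 = 0) :
    QuasiconvexAtZero μ fun Y => ∫ s in (0 : ℝ)..1, g (Y + (θ Y * v s) • ℓ.smulRight p) where
  continuous := by
    have hgc := hg.continuous
    have hvc := hv.continuous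
    have hθc := hθ.continuous
    exact intervalIntegral.continuous_parametric_intervalIntegral_of_continuous'
      (by simp only [uncurry_def]; fun_prop) 0 1
  map_zero := by simp [hθ0, hg.map_zero]
  integral_nonneg φ hφ hφc := by
    refine hg.integral_oscillation_nonneg hφ hφc
      (χ := fun x => θ (fderiv ℝ φ x)) (hθ.comp (hφ.fderiv_right (by simp))) ?_ hℓ p hv hper hmean
    exact (hφc.fderiv ℝ).comp_left hθ0

/-- If the average of `g` over a rank-one splitting of `X` is below `c`, then `g` may be replaced
by an integrand in the same class with value below `c` at `X` and not larger at finitely many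
prescribed points. At `X = 0` no replacement is needed since the average is already bounded below by
`g 0`. -/
theorem QuasiconvexAtZero.exists_lt_of_rankOne_split [FiniteDimensional ℝ F]
    {g : (E →L[ℝ] F) → ℝ} (hg : QuasiconvexAtZero μ g) {ℓ : E →L[ℝ] ℝ} (hℓ : ℓ ≠ 0) (p : F)
    {lam : ℝ} (h0 : 0 < lam) (h1 : lam < 1) (X : E →L[ℝ] F) {c : ℝ}
    (hc : lam * g (X + (1 - lam) • ℓ.smulRight p) + (1 - lam) * g (X + (-lam) • ℓ.smulRight p) < c)
    {S : Set (E →L[ℝ] F)} (hS : S.Finite) :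
    ∃ g' : (E →L[ℝ] F) → ℝ, QuasiconvexAtZero μ g' ∧ g' X < c ∧ ∀ Y ∈ S, g' Y ≤ g Y := by
  -- Where `g X ≥ c`, lowering the value at `X` below `c` does no harm even if `X ∈ S`.
  by_cases hgX : g X < c
  · exact ⟨g, hg, hgX, fun _ _ => le_rfl⟩
  obtain ⟨v, hv, hper, hmean, hlim⟩ := exists_smooth_periodic_profile h0 h1
  have hgc := hg.continuous
  have hlimX := hlim (fun r => g (X + r • ℓ.smulRight p)) (by fun_prop)
  have hX : X ≠ 0 := by
    rintro rfl
    refine hgX ((hg.map_zero.le.trans ?_).trans_lt hc)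
    refine ge_of_tendsto' hlimX fun k => ?_
    simpa using hg.intervalIntegral_nonneg hℓ p (hv k) (hper k) (hmean k)
  obtain ⟨k, hk⟩ := (hlimX.eventually_lt_const hc).exists
  have hopen : (insert 0 S \ {X})ᶜ ∈ 𝓝 X :=
    ((hS.insert 0).subset sdiff_subset).isClosed.isOpen_compl.mem_nhds (by simp)
  obtain ⟨r, hr, hball⟩ := Metric.mem_nhds_iff.1 hopen
  let θ : ContDiffBump X := ⟨r / 2, r, half_pos hr, half_lt_self hr⟩
  have hθ : ∀ Y ∈ insert 0 S, Y ≠ X → θ Y = 0 := by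
    intro Y hY hYX
    refine θ.zero_of_le_dist (not_lt.1 fun h => ?_)
    exact hball h ⟨hY, hYX⟩
  have hlt : ∫ s in (0 : ℝ)..1, g (X + (θ X * v k s) • ℓ.smulRight p) < c := by
    have : θ X = 1 := θ.one_of_mem_closedBall (Metric.mem_closedBall_self (half_pos hr).le)
    simpa [this] using hk
  refine ⟨_, hg.average hℓ p (hv k) (hper k) (hmean k) θ.contDiff
    (hθ 0 (mem_insert _ _) hX.symm), hlt, fun Y hY => ?_⟩
  by_cases hYX : Y = X
  · subst hYX
    exact hlt.le.trans (not_lt.1 hgX)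
  · simp [hθ Y (mem_insert_of_mem _ hY) hYX]

end Relaxation

/-! ### Jensen's inequality along a loop of rank-one splittings -/

section Chain

variable {E F : Type*} [NormedAddCommGroup E] [NormedSpace ℝ E] [FiniteDimensional ℝ E]
  [MeasurableSpace E] [BorelSpace E] [NormedAddCommGroup F] [NormedSpace ℝ F]
  {μ : Measure E} [μ.IsAddHaarMeasure]

/-- Jensen's inequality along a chain of rank-one splittings. Each `X (i + 1)` lies on the segment
from `X i` to `Y i`, a rank-one segment, so the values `c i` obtained by averaging
`g (Y 0), …, g (Y (i - 1))` and `g 0` successively are reached, up to an arbitrarily small error, by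
relaxing `g`. -/
theorem QuasiconvexAtZero.exists_lt_of_chain [FiniteDimensional ℝ F]
    {g : (E →L[ℝ] F) → ℝ} (hg : QuasiconvexAtZero μ g) {N : ℕ}
    {X : ℕ → E →L[ℝ] F} {Y R : Fin N → E →L[ℝ] F} {κ : Fin N → ℝ} {c : ℕ → ℝ}
    (hR : ∀ i, ∃ (ℓ : E →L[ℝ] ℝ) (p : F), ℓ ≠ 0 ∧ R i = ℓ.smulRight p)
    (hκ : ∀ i, 1 < κ i) (hX0 : X 0 = 0) (hX : ∀ i : Fin N, X (i + 1) = X i + R i)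
    (hY : ∀ i : Fin N, Y i = X i + κ i • R i) (hc0 : c 0 = 0)
    (hc : ∀ i : Fin N, c (i + 1) = (1 - (κ i)⁻¹) * c i + (κ i)⁻¹ * g (Y i))
    (k : ℕ) (hk : k ≤ N) (b : ℝ) (hb : c k < b) :
    ∃ g' : (E →L[ℝ] F) → ℝ, QuasiconvexAtZero μ g' ∧ g' (X k) < b ∧ ∀ i, g' (Y i) ≤ g (Y i) := by
  induction k generalizing b with
  | zero => exact ⟨g, hg, by rwa [hX0, hg.map_zero, ← hc0], fun _ => le_rfl⟩
  | succ k ih =>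
    set i : Fin N := ⟨k, hk⟩ with hi
    have hκ0 : 0 < κ i := zero_lt_one.trans (hκ i)
    have hlam0 : 0 < (κ i)⁻¹ := inv_pos.2 hκ0
    have hlam1 : (κ i)⁻¹ < 1 := inv_lt_one_of_one_lt₀ (hκ i)
    have hci : c (k + 1) = (1 - (κ i)⁻¹) * c k + (κ i)⁻¹ * g (Y i) := hc i
    obtain ⟨g₁, hg₁, hg₁X, hg₁Y⟩ := ih (by omega) (c k + (b - c (k + 1))) (by linarith)
    obtain ⟨ℓ, p, hℓ, hRi⟩ := hR i
    have hXi : X (k + 1) = X k + R i := hX i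
    have hYi : Y i = X k + κ i • R i := hY i
    -- In terms of `lam = 1 / κ i`, the endpoints `Y i` and `X k` are obtained from `X (k + 1)` by
    -- moving `1 - lam` and `-lam` times along `κ i • R i`.
    have hRκ : ℓ.smulRight (κ i • p) = κ i • R i := by
      rw [hRi]
      ext x
      exact smul_comm _ _ _
    have e1 : X (k + 1) + (1 - (κ i)⁻¹) • ℓ.smulRight (κ i • p) = Y i := by
      rw [hRκ, hXi, hYi, sub_smul, one_smul, inv_smul_smul₀ hκ0.ne']
      abel
    have e2 : X (k + 1) + (-(κ i)⁻¹) • ℓ.smulRight (κ i • p) = X k := by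
      rw [hRκ, hXi, neg_smul, inv_smul_smul₀ hκ0.ne']
      abel
    obtain ⟨g₂, hg₂, hg₂X, hg₂Y⟩ := hg₁.exists_lt_of_rankOne_split hℓ (κ i • p) hlam0 hlam1
      (X (k + 1)) (c := b) (S := range Y) (by
        rw [e1, e2]
        have h1 := mul_le_mul_of_nonneg_left (hg₁Y i) hlam0.le
        have h2 := mul_lt_mul_of_pos_left hg₁X (sub_pos.2 hlam1)
        have h3 : 0 < (κ i)⁻¹ * (b - c (k + 1)) := mul_pos hlam0 (sub_pos.2 hb)
        nlinarith) (finite_range Y)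
    exact ⟨g₂, hg₂, hg₂X, fun j => (hg₂Y _ (mem_range_self j)).trans (hg₁Y j)⟩

/-- When the chain closes up at the origin, the final average is nonnegative. -/
theorem QuasiconvexAtZero.nonneg_of_loop [FiniteDimensional ℝ F]
    {g : (E →L[ℝ] F) → ℝ} (hg : QuasiconvexAtZero μ g) {N : ℕ}
    {X : ℕ → E →L[ℝ] F} {Y R : Fin N → E →L[ℝ] F} {κ : Fin N → ℝ} {c : ℕ → ℝ}
    (hR : ∀ i, ∃ (ℓ : E →L[ℝ] ℝ) (p : F), ℓ ≠ 0 ∧ R i = ℓ.smulRight p)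
    (hκ : ∀ i, 1 < κ i) (hX0 : X 0 = 0) (hXN : X N = 0)
    (hX : ∀ i : Fin N, X (i + 1) = X i + R i)
    (hY : ∀ i : Fin N, Y i = X i + κ i • R i) (hc0 : c 0 = 0)
    (hc : ∀ i : Fin N, c (i + 1) = (1 - (κ i)⁻¹) * c i + (κ i)⁻¹ * g (Y i)) :
    0 ≤ c N := by
  refine le_of_forall_gt fun b hb => ?_
  obtain ⟨g', hg', hlt, -⟩ := hg.exists_lt_of_chain hR hκ hX0 hX hY hc0 hc N le_rfl b hb
  rwa [hXN, hg'.map_zero] at hlt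

end Chain

/-! ### The Frobenius pairing, and matrices as linear maps -/

section Frobenius

variable {m n : ℕ}

theorem frobeniusInner_eq_sum (A B : Matrix (Fin m) (Fin n) ℝ) :
    frobeniusInner A B = ∑ j, ∑ i, A i j * B i j := by
  simp [frobeniusInner, Matrix.trace, Matrix.mul_apply]

theorem frobeniusInner_comm (A B : Matrix (Fin m) (Fin n) ℝ) :
    frobeniusInner A B = frobeniusInner B A := by
  simp [frobeniusInner_eq_sum, mul_comm]

theorem frobeniusInner_add_left (A B C : Matrix (Fin m) (Fin n) ℝ) :
    frobeniusInner (A + B) C = frobeniusInner A C + frobeniusInner B C := by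
  simp [frobeniusInner, Matrix.add_mul]

theorem frobeniusInner_add_right (A B C : Matrix (Fin m) (Fin n) ℝ) :
    frobeniusInner A (B + C) = frobeniusInner A B + frobeniusInner A C := by
  simp [frobeniusInner, Matrix.mul_add]

theorem frobeniusInner_smul_left (t : ℝ) (A B : Matrix (Fin m) (Fin n) ℝ) :
    frobeniusInner (t • A) B = t * frobeniusInner A B := by
  simp [frobeniusInner]

theorem frobeniusInner_smul_right (t : ℝ) (A B : Matrix (Fin m) (Fin n) ℝ) :
    frobeniusInner A (t • B) = t * frobeniusInner A B := by
  simp [frobeniusInner]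

theorem frobeniusInner_self_nonneg (A : Matrix (Fin m) (Fin n) ℝ) : 0 ≤ frobeniusInner A A := by
  rw [frobeniusInner_eq_sum]
  exact Finset.sum_nonneg fun j _ => Finset.sum_nonneg fun i _ => mul_self_nonneg _

theorem frobeniusInner_self_eq_zero {A : Matrix (Fin m) (Fin n) ℝ} (h : frobeniusInner A A = 0) :
    A = 0 := by
  rw [frobeniusInner_eq_sum, Finset.sum_eq_zero_iff_of_nonneg
    fun j _ => Finset.sum_nonneg fun i _ => mul_self_nonneg _] at h
  ext i j
  have := (Finset.sum_eq_zero_iff_of_nonneg fun i _ => mul_self_nonneg (A i j)).1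
    (h j (Finset.mem_univ j)) i (Finset.mem_univ i)
  simpa using this

theorem frobeniusInner_vecMulVec (p : Fin m → ℝ) (a : Fin n → ℝ) (B : Matrix (Fin m) (Fin n) ℝ) :
    frobeniusInner (Matrix.vecMulVec p a) B = p ⬝ᵥ B.mulVec a := by
  rw [frobeniusInner_eq_sum, Finset.sum_comm]
  simp only [dotProduct, Matrix.mulVec, Matrix.vecMulVec_apply, Finset.mul_sum]
  exact Finset.sum_congr rfl fun i _ => Finset.sum_congr rfl fun j _ => by ring

theorem Continuous.frobeniusInner {α : Type*} [TopologicalSpace α]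
    {f g : α → Matrix (Fin m) (Fin n) ℝ} (hf : Continuous f) (hg : Continuous g) :
    Continuous fun x => frobeniusInner (f x) (g x) :=
  (hf.matrix_transpose.matrix_mul hg).matrix_trace

/-- The wave cone is null for the pairing `(A, B) ↦ ⟨A, B⟩`. -/
theorem frobeniusInner_eq_zero_of_mem_waveCone
    {γ : Matrix (Fin m) (Fin n) ℝ × Matrix (Fin m) (Fin n) ℝ} (h : γ ∈ waveCone m n) :
    frobeniusInner γ.1 γ.2 = 0 := by
  obtain ⟨p, a, B, -, hB, rfl⟩ := h
  simp [frobeniusInner_vecMulVec, hB]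

/-- The matrix of a linear map in the standard bases; applied to `fderiv ℝ φ x` it is
`gradMatrix φ x` by definition. -/
noncomputable def euclideanMatrix (L : EuclideanSpace ℝ (Fin n) →L[ℝ] EuclideanSpace ℝ (Fin m)) :
    Matrix (Fin m) (Fin n) ℝ :=
  Matrix.of fun i j => L (EuclideanSpace.single j 1) i

/-- The continuous linear map with a given matrix in the standard bases. -/
noncomputable def euclideanMap (A : Matrix (Fin m) (Fin n) ℝ) :
    EuclideanSpace ℝ (Fin n) →L[ℝ] EuclideanSpace ℝ (Fin m) :=
  (Matrix.toEuclideanLin A).toContinuousLinearMap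

theorem euclideanMap_apply (A : Matrix (Fin m) (Fin n) ℝ) (x : EuclideanSpace ℝ (Fin n))
    (i : Fin m) : euclideanMap A x i = ∑ j, A i j * x j := by
  simp [euclideanMap, Matrix.toLpLin_apply, Matrix.mulVec, dotProduct]

theorem euclideanMatrix_euclideanMap (A : Matrix (Fin m) (Fin n) ℝ) :
    euclideanMatrix (euclideanMap A) = A := by
  ext i j
  simp [euclideanMatrix, euclideanMap_apply]

theorem euclideanMatrix_zero :
    euclideanMatrix (0 : EuclideanSpace ℝ (Fin n) →L[ℝ] EuclideanSpace ℝ (Fin m)) = 0 := by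
  ext i j
  simp [euclideanMatrix]

theorem continuous_euclideanMatrix :
    Continuous (euclideanMatrix (m := m) (n := n)) := by
  refine continuous_matrix fun i j => ?_
  simp only [euclideanMatrix, Matrix.of_apply]
  fun_prop

theorem euclideanMap_add (A B : Matrix (Fin m) (Fin n) ℝ) :
    euclideanMap (A + B) = euclideanMap A + euclideanMap B := by
  simp [euclideanMap]

theorem euclideanMap_smul (t : ℝ) (A : Matrix (Fin m) (Fin n) ℝ) :
    euclideanMap (t • A) = t • euclideanMap A := by
  simp [euclideanMap]

theorem exists_euclideanMap_vecMulVec (p : Fin m → ℝ) {a : Fin n → ℝ} (ha : a ≠ 0) :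
    ∃ (ℓ : EuclideanSpace ℝ (Fin n) →L[ℝ] ℝ) (q : EuclideanSpace ℝ (Fin m)),
      ℓ ≠ 0 ∧ euclideanMap (Matrix.vecMulVec p a) = ℓ.smulRight q := by
  refine ⟨innerSL ℝ (WithLp.toLp 2 a), WithLp.toLp 2 p, ?_, ?_⟩
  · intro h
    have := DFunLike.congr_fun h (WithLp.toLp 2 a)
    simp only [innerSL_apply_apply, zero_apply, inner_self_eq_zero] at this
    exact ha (by simpa using this)
  · ext x i
    rw [euclideanMap_apply]
    simp [Matrix.vecMulVec_apply, PiLp.inner_apply, Finset.sum_mul]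
    exact Finset.sum_congr rfl fun j _ => by ring

end Frobenius

/-! ### From strong quasimonotonicity to quasiconvexity at the origin -/

section Transfer

variable {m n : ℕ}

/-- The integrand `L ↦ ⟨σ(A + L), L⟩ - ν |L|²` of strong quasimonotonicity at `A`. -/
noncomputable def monotonicityDefect (σ : Matrix (Fin m) (Fin n) ℝ → Matrix (Fin m) (Fin n) ℝ)
    (ν : ℝ) (A : Matrix (Fin m) (Fin n) ℝ)
    (L : EuclideanSpace ℝ (Fin n) →L[ℝ] EuclideanSpace ℝ (Fin m)) : ℝ :=
  frobeniusInner (σ (A + euclideanMatrix L)) (euclideanMatrix L) -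
    ν * frobeniusInner (euclideanMatrix L) (euclideanMatrix L)

/-- By scaling and translating test functions, strong quasimonotonicity on an open set implies the
same inequality for test functions on the whole space. -/
theorem IsStronglyQuasimonotone.quasiconvexAtZero {Ω : Set (EuclideanSpace ℝ (Fin n))}
    (hΩo : IsOpen Ω) (hΩ : Ω.Nonempty)
    {σ : Matrix (Fin m) (Fin n) ℝ → Matrix (Fin m) (Fin n) ℝ} (hσ : Continuous σ) {ν : ℝ}
    (h : IsStronglyQuasimonotone Ω σ ν) (A : Matrix (Fin m) (Fin n) ℝ) :
    QuasiconvexAtZero volume (monotonicityDefect σ ν A) where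
  continuous := by
    have hM := continuous_euclideanMatrix (m := m) (n := n)
    exact ((hσ.comp (continuous_const.add hM)).frobeniusInner hM).sub
      (continuous_const.mul (hM.frobeniusInner hM))
  map_zero := by simp [monotonicityDefect, euclideanMatrix_zero, frobeniusInner]
  integral_nonneg φ hφ hφc := by
    obtain ⟨x₀, hx₀⟩ := hΩ
    obtain ⟨r₀, hr₀, hball⟩ := Metric.isOpen_iff.1 hΩo x₀ hx₀
    obtain ⟨R, hR0, hR⟩ := hφc.isCompact.isBounded.subset_closedBall_lt 0 0
    set r : ℝ := r₀ / (R + 1) with hr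
    have hrpos : 0 < r := by positivity
    have hrR : r * R < r₀ := by
      rw [hr, div_mul_eq_mul_div, div_lt_iff₀ (by positivity)]
      nlinarith
    set φ' : EuclideanSpace ℝ (Fin n) → EuclideanSpace ℝ (Fin m) :=
      fun x => r • φ (r⁻¹ • (x - x₀)) with hφ'
    have hout : ∀ x ∉ Metric.closedBall x₀ (r * R), r⁻¹ • (x - x₀) ∉ tsupport φ := by
      intro x hx hmem
      have h1 := hR hmem
      rw [mem_closedBall_zero_iff, norm_smul, norm_inv, Real.norm_of_nonneg hrpos.le,
        inv_mul_le_iff₀ hrpos, ← dist_eq_norm] at h1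
      exact hx h1
    have hsub : Metric.closedBall x₀ (r * R) ⊆ Ω :=
      (Metric.closedBall_subset_ball hrR).trans hball
    have hts : tsupport φ' ⊆ Metric.closedBall x₀ (r * R) := by
      refine closure_minimal (fun x hx => ?_) Metric.isClosed_closedBall
      by_contra hxn
      exact hx (by simp [hφ', image_eq_zero_of_notMem_tsupport (hout x hxn)])
    have hcs : HasCompactSupport φ' :=
      (isCompact_closedBall x₀ (r * R)).of_isClosed_subset (isClosed_tsupport φ') hts
    have hsm : ContDiff ℝ ∞ φ' :=
      (hφ.comp ((contDiff_id.sub contDiff_const).const_smul r⁻¹)).const_smul r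
    have hgrad : ∀ x, fderiv ℝ φ' x = fderiv ℝ φ (r⁻¹ • (x - x₀)) := by
      intro x
      have h1 : HasFDerivAt (fun x => r⁻¹ • (x - x₀))
          (r⁻¹ • ContinuousLinearMap.id ℝ (EuclideanSpace ℝ (Fin n))) x :=
        ((hasFDerivAt_id x).sub_const x₀).const_smul r⁻¹
      have h2 := ((((hφ.differentiable (by simp)) (r⁻¹ • (x - x₀))).hasFDerivAt.comp x
        h1).const_smul r)
      rw [HasFDerivAt.fderiv (f := φ') h2]
      ext y
      simp [smul_smul, hrpos.ne']
    have hq := h A φ' hsm hcs (hts.trans hsub)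
    have hM := continuous_euclideanMatrix (m := m) (n := n)
    have hG : Continuous (gradMatrix φ') := hM.comp (hsm.continuous_fderiv (by simp))
    have hG0 : ∀ x ∉ Metric.closedBall x₀ (r * R), gradMatrix φ' x = 0 := by
      intro x hx
      have : fderiv ℝ φ' x = 0 := notMem_support.1 fun hs =>
        hx (hts (support_fderiv_subset ℝ hs))
      ext i j
      simp [gradMatrix, this]
    have hI : ∀ f : EuclideanSpace ℝ (Fin n) → ℝ, Continuous f →
        (∀ x ∉ Metric.closedBall x₀ (r * R), f x = 0) →
        Integrable f ∧ ∫ x in Ω, f x = ∫ x, f x := fun f hf hf0 =>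
      ⟨hf.integrable_of_hasCompactSupport (HasCompactSupport.intro (isCompact_closedBall _ _) hf0),
        setIntegral_eq_integral_of_forall_compl_eq_zero fun x hx => hf0 x fun h' => hx (hsub h')⟩
    obtain ⟨hi₁, he₁⟩ := hI (fun x => frobeniusInner (gradMatrix φ' x) (gradMatrix φ' x))
      (hG.frobeniusInner hG) fun x hx => by simp [hG0 x hx, frobeniusInner]
    obtain ⟨hi₂, he₂⟩ := hI
      (fun x => frobeniusInner (σ (A + gradMatrix φ' x)) (gradMatrix φ' x))
      ((hσ.comp (continuous_const.add hG)).frobeniusInner hG)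
      fun x hx => by simp [hG0 x hx, frobeniusInner]
    rw [he₁, he₂, ← integral_const_mul, ← sub_nonneg,
      ← integral_sub hi₂ (hi₁.const_mul ν)] at hq
    have hscale : ∫ x, (frobeniusInner (σ (A + gradMatrix φ' x)) (gradMatrix φ' x) -
        ν * frobeniusInner (gradMatrix φ' x) (gradMatrix φ' x)) =
        r ^ n * ∫ x, monotonicityDefect σ ν A (fderiv ℝ φ x) := by
      have h1 : ∀ x, frobeniusInner (σ (A + gradMatrix φ' x)) (gradMatrix φ' x) -
          ν * frobeniusInner (gradMatrix φ' x) (gradMatrix φ' x) =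
          monotonicityDefect σ ν A (fderiv ℝ φ (r⁻¹ • (x - x₀))) := by
        intro x
        rw [← hgrad]
        rfl
      simp only [h1]
      rw [integral_sub_right_eq_self
        (fun x => monotonicityDefect σ ν A (fderiv ℝ φ (r⁻¹ • x))) x₀,
        Measure.integral_comp_inv_smul_of_nonneg volume
          (fun x => monotonicityDefect σ ν A (fderiv ℝ φ x)) hrpos.le]
      simp
    rw [hscale] at hq
    exact nonneg_of_mul_nonneg_right hq (by positivity)

end Transfer

/-! ### Geometry of the configurations -/

section Configuration

variable {m n N : ℕ}

/-- The points `π_k = ρ + ∑_{j < k} γ_j` indexed by natural numbers, so that the point after the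
last one, which closes the loop, is available. -/
def basePointNat (ρ : Matrix (Fin m) (Fin n) ℝ × Matrix (Fin m) (Fin n) ℝ)
    (γ : Fin N → Matrix (Fin m) (Fin n) ℝ × Matrix (Fin m) (Fin n) ℝ) (k : ℕ) :
    Matrix (Fin m) (Fin n) ℝ × Matrix (Fin m) (Fin n) ℝ :=
  ρ + ∑ j with j.val < k, γ j

variable {ξ : Fin N → Matrix (Fin m) (Fin n) ℝ × Matrix (Fin m) (Fin n) ℝ}
  {ρ : Matrix (Fin m) (Fin n) ℝ × Matrix (Fin m) (Fin n) ℝ}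
  {γ : Fin N → Matrix (Fin m) (Fin n) ℝ × Matrix (Fin m) (Fin n) ℝ} {κ : Fin N → ℝ}

theorem basePoint_eq_basePointNat (i : Fin N) : basePoint ρ γ i = basePointNat ρ γ i := by
  unfold basePoint basePointNat
  congr 2
  ext j
  simp

theorem basePointNat_zero : basePointNat ρ γ 0 = ρ := by
  simp [basePointNat]

theorem basePointNat_succ (i : Fin N) :
    basePointNat ρ γ (i + 1) = basePointNat ρ γ i + γ i := by
  have : (Finset.univ.filter fun j : Fin N => j.val < i + 1) =
      insert i (Finset.univ.filter fun j : Fin N => j.val < i) := by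
    ext j
    simp [Fin.ext_iff]
    omega
  unfold basePointNat
  rw [this, Finset.sum_insert (by simp)]
  abel

theorem IsTNConfigurationWith.basePointNat_last (h : IsTNConfigurationWith ξ ρ γ κ) :
    basePointNat ρ γ N = ρ := by
  simp [basePointNat, h.sum_eq_zero]

theorem IsTNConfigurationWith.eq_basePointNat_add (h : IsTNConfigurationWith ξ ρ γ κ)
    (i : Fin N) : ξ i = basePointNat ρ γ i + κ i • γ i := by
  rw [h.eq_add i, basePoint_eq_basePointNat]

/-- If all the `ξ i` coincide, the whole configuration degenerates to one point: each
`π_{i+1}` is a proper convex combination of `π_i` and that point, and the `π_i` form a loop. -/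
theorem IsTNConfigurationWith.basePoint_eq_of_const (h : IsTNConfigurationWith ξ ρ γ κ)
    {z : Matrix (Fin m) (Fin n) ℝ × Matrix (Fin m) (Fin n) ℝ} (hz : ∀ i, ξ i = z) (i : Fin N) :
    basePoint ρ γ i = z := by
  have hstep : ∀ i : Fin N, basePointNat ρ γ (i + 1) - z =
      (1 - (κ i)⁻¹) • (basePointNat ρ γ i - z) := by
    intro i
    have hκ : κ i ≠ 0 := (zero_lt_one.trans (h.one_lt i)).ne'
    have hγ : γ i = (κ i)⁻¹ • (z - basePointNat ρ γ i) := by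
      rw [← hz i, h.eq_basePointNat_add i, add_sub_cancel_left, inv_smul_smul₀ hκ]
    rw [basePointNat_succ, hγ]
    module
  have hcontr : ∀ k ≤ N, ∃ t : ℝ, 0 ≤ t ∧ (0 < k → t < 1) ∧ t ≤ 1 ∧
      basePointNat ρ γ k - z = t • (ρ - z) := by
    intro k
    induction k with
    | zero => exact fun _ => ⟨1, by simp [basePointNat_zero]⟩
    | succ k ih =>
      intro hk
      obtain ⟨t, ht0, -, ht1, ht⟩ := ih (by omega)
      have hκ := h.one_lt ⟨k, hk⟩
      have hl0 : 0 < (κ ⟨k, hk⟩)⁻¹ := inv_pos.2 (zero_lt_one.trans hκ)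
      have hl1 : (κ ⟨k, hk⟩)⁻¹ < 1 := inv_lt_one_of_one_lt₀ hκ
      have hlt : (1 - (κ ⟨k, hk⟩)⁻¹) * t < 1 := by nlinarith
      refine ⟨(1 - (κ ⟨k, hk⟩)⁻¹) * t, mul_nonneg (by linarith) ht0, fun _ => hlt, hlt.le, ?_⟩
      rw [mul_smul, ← ht]
      exact hstep ⟨k, hk⟩
  have hρ : ρ - z = 0 := by
    -- The contraction factor of a full turn is below `1`, while the loop returns to `ρ`.
    obtain ⟨t, -, ht1, -, ht⟩ := hcontr N le_rfl
    rw [h.basePointNat_last] at ht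
    have h1 : (1 - t) • (ρ - z) = 0 := by rw [sub_smul, one_smul, ← ht, sub_self]
    exact (smul_eq_zero.1 h1).resolve_left (sub_pos.2 (ht1 i.pos)).ne'
  obtain ⟨t, -, -, -, ht⟩ := hcontr i i.2.le
  rw [hρ, smul_zero, sub_eq_zero] at ht
  rw [basePoint_eq_basePointNat, ht]

/-- The pairing `(A, B) ↦ ⟨A - A₀, B⟩` is affine along directions of the wave cone. -/
theorem frobeniusInner_affine_of_mem_waveCone
    {γ₀ P : Matrix (Fin m) (Fin n) ℝ × Matrix (Fin m) (Fin n) ℝ} (hγ : γ₀ ∈ waveCone m n)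
    (A₀ : Matrix (Fin m) (Fin n) ℝ) {t : ℝ} (ht : t ≠ 0) :
    frobeniusInner ((P + γ₀).1 - A₀) (P + γ₀).2 =
      (1 - t⁻¹) * frobeniusInner (P.1 - A₀) P.2 +
        t⁻¹ * frobeniusInner ((P + t • γ₀).1 - A₀) (P + t • γ₀).2 := by
  have h0 := frobeniusInner_eq_zero_of_mem_waveCone hγ
  have h1 : ∀ s : ℝ, frobeniusInner ((P + s • γ₀).1 - A₀) (P + s • γ₀).2 =
      frobeniusInner (P.1 - A₀) P.2 +
        s * (frobeniusInner (P.1 - A₀) γ₀.2 + frobeniusInner γ₀.1 P.2) := by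
    intro s
    have : (P + s • γ₀).1 - A₀ = (P.1 - A₀) + s • γ₀.1 := by
      rw [Prod.fst_add, Prod.smul_fst]
      abel
    rw [this, Prod.snd_add, Prod.smul_snd]
    simp only [frobeniusInner_add_left, frobeniusInner_add_right, frobeniusInner_smul_left,
      frobeniusInner_smul_right, h0]
    ring
  have h2 := h1 1
  rw [one_smul] at h2
  rw [h2, h1 t]
  field_simp
  ring

/-- Successive averages of nonnegative numbers, started at zero, control every number averaged. -/
theorem eq_zero_of_iterated_average_nonpos {N : ℕ} {κ e : Fin N → ℝ} {d : ℕ → ℝ}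
    (hκ : ∀ i, 1 < κ i) (he : ∀ i, 0 ≤ e i) (hd0 : d 0 = 0)
    (hd : ∀ i : Fin N, d (i + 1) = (1 - (κ i)⁻¹) * d i + (κ i)⁻¹ * e i) (hdN : d N ≤ 0)
    (i : Fin N) : e i = 0 := by
  have key : ∀ k ≤ N, 0 ≤ d k ∧ (d k ≤ 0 → ∀ j : Fin N, j.val < k → e j = 0) := by
    intro k
    induction k with
    | zero => exact fun _ => ⟨hd0.ge, fun _ j hj => absurd hj (Nat.not_lt_zero _)⟩
    | succ k ih =>
      intro hk
      obtain ⟨h1, h2⟩ := ih (by omega)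
      set i : Fin N := ⟨k, hk⟩ with hi
      have hl0 : 0 < (κ i)⁻¹ := inv_pos.2 (zero_lt_one.trans (hκ i))
      have hl1 : 0 < 1 - (κ i)⁻¹ := sub_pos.2 (inv_lt_one_of_one_lt₀ (hκ i))
      have hdk : d (k + 1) = (1 - (κ i)⁻¹) * d k + (κ i)⁻¹ * e i := hd i
      have ha := mul_nonneg hl1.le h1
      have hb := mul_nonneg hl0.le (he i)
      refine ⟨by linarith, fun hle j hj => ?_⟩
      rcases Nat.lt_succ_iff_lt_or_eq.1 hj with hj | hj
      · refine h2 ?_ j hj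
        nlinarith
      · have hji : j = i := Fin.ext hj
        rw [hji]
        have : e i ≤ 0 := by nlinarith
        exact this.antisymm (he i)
  exact (key N le_rfl).2 hdN i i.2

end Configuration

/-! ### Collapse of the configuration -/

theorem mainTheorem6 {m n N : ℕ} (hm : 1 ≤ m) (hn : 1 ≤ n) (hN : 2 ≤ N)
    (Ω : Set (EuclideanSpace ℝ (Fin n)))
    (hΩo : IsOpen Ω) (hΩc : IsConnected Ω) (hΩb : Bornology.IsBounded Ω)
    (σ : Matrix (Fin m) (Fin n) ℝ → Matrix (Fin m) (Fin n) ℝ) (hσ : Continuous σ)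
    (ξ : Fin N → Matrix (Fin m) (Fin n) ℝ × Matrix (Fin m) (Fin n) ℝ)
    (ρ : Matrix (Fin m) (Fin n) ℝ × Matrix (Fin m) (Fin n) ℝ)
    (γ : Fin N → Matrix (Fin m) (Fin n) ℝ × Matrix (Fin m) (Fin n) ℝ)
    (κ : Fin N → ℝ)
    (hξ : IsTNConfigurationWith ξ ρ γ κ)
    (hsupp : ∀ i, ξ i ∈ fluxGraph σ)
    (hT : (configurationSet ξ ρ γ \ fluxGraph σ).Nonempty) :
    ∀ ν : ℝ, 0 < ν → ¬ IsStronglyQuasimonotone Ω σ ν := by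
  intro ν hν hqm
  have hg := hqm.quasiconvexAtZero hΩo hΩc.nonempty hσ ρ.1
  set Y : Fin N → Matrix (Fin m) (Fin n) ℝ := fun i => (ξ i).1 - ρ.1 with hY
  -- `d` averages the coercive terms `ν |A_i - A|²` round the loop; subtracting it from the affine
  -- pairing gives the averages of the integrand `monotonicityDefect σ ν ρ.1`.
  let d : ℕ → ℝ := fun k => Nat.rec 0 (fun k r => if h : k < N then
    (1 - (κ ⟨k, h⟩)⁻¹) * r + (κ ⟨k, h⟩)⁻¹ * (ν * frobeniusInner (Y ⟨k, h⟩) (Y ⟨k, h⟩)) else r) k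
  have hd : ∀ i : Fin N, d (i + 1) =
      (1 - (κ i)⁻¹) * d i + (κ i)⁻¹ * (ν * frobeniusInner (Y i) (Y i)) :=
    fun i => dif_pos i.2
  set π := basePointNat ρ γ with hπ
  have hgraph : ∀ i, (ξ i).2 = σ (ξ i).1 := by
    intro i
    obtain ⟨A, hA⟩ := hsupp i
    rw [← hA]
  have hloop := hg.nonneg_of_loop (N := N)
    (X := fun k => euclideanMap ((π k).1 - ρ.1)) (Y := fun i => euclideanMap (Y i))
    (R := fun i => euclideanMap (γ i).1) (κ := κ)
    (c := fun k => frobeniusInner ((π k).1 - ρ.1) (π k).2 - d k)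
    (fun i => by
      obtain ⟨p, a, B, ha, -, h⟩ := hξ.mem_cone i
      rw [h]
      exact exists_euclideanMap_vecMulVec p ha)
    hξ.one_lt
    (by simp [hπ, basePointNat_zero, euclideanMap])
    (by simp [hπ, hξ.basePointNat_last, euclideanMap])
    (fun i => by
      rw [← euclideanMap_add, hπ, basePointNat_succ, Prod.fst_add, add_sub_right_comm])
    (fun i => by
      rw [← euclideanMap_smul, ← euclideanMap_add]
      simp only [hY, hπ]
      rw [hξ.eq_basePointNat_add i, Prod.fst_add, Prod.smul_fst, add_sub_right_comm])
    (by simp [hπ, basePointNat_zero, frobeniusInner, d])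
    (fun i => by
      have hκ : κ i ≠ 0 := (zero_lt_one.trans (hξ.one_lt i)).ne'
      simp only [monotonicityDefect, euclideanMatrix_euclideanMap]
      rw [hd i, hπ, basePointNat_succ,
        frobeniusInner_affine_of_mem_waveCone (hξ.mem_cone i) ρ.1 hκ, ← hξ.eq_basePointNat_add i,
        hgraph i, frobeniusInner_comm ((ξ i).1 - ρ.1)]
      simp only [hY, add_sub_cancel]
      ring)
  have hdN : d N ≤ 0 := by
    simpa [hπ, hξ.basePointNat_last, frobeniusInner] using hloop
  have hY0 : ∀ i, Y i = 0 := fun i => by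
    have := eq_zero_of_iterated_average_nonpos hξ.one_lt
      (fun i => mul_nonneg hν.le (frobeniusInner_self_nonneg (Y i))) rfl hd hdN i
    exact frobeniusInner_self_eq_zero ((mul_eq_zero.1 this).resolve_left hν.ne')
  have hconst : ∀ i, ξ i = (ρ.1, σ ρ.1) := fun i => by
    have h1 : (ξ i).1 = ρ.1 := sub_eq_zero.1 (hY0 i)
    exact Prod.ext h1 (by rw [hgraph i, h1])
  obtain ⟨x, hx, hxK⟩ := hT
  obtain ⟨j, hj⟩ := mem_iUnion.1 hx
  rw [hconst j, hξ.basePoint_eq_of_const hconst j, segment_same] at hj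
  exact hxK ⟨ρ.1, (mem_singleton_iff.1 hj).symm⟩
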